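/- Consider the linear time-invariant plant $$\dot x = Ax+B_1w+B_2u,\qquad y=C_1x+D_1w,\qquad z=C_2x+D_2u$$ with real matrices and $x(t)\in\mathbb R^n$, $u(t)\in\mathbb R^m$, $y(t)\in\mathbb R^k$, $w(t)\in\mathbb R^{p}$, $z(t)\in\mathbb R^{q}$. Assume that $(A,B_2)$ is stabilizable, $(C_1,A)$ is detectable, $(A,B_1)$ is controllable, $(C_2,A)$ is observable, $B_1D_1^\top=0$, $C_2^\top D_2=0$, and that $D_1D_1^\top$ and $D_2^\top D_2$ are invertible. For $K\in\mathbb R^{m\times n}$, $L\in\mathbb R^{n\times k}$ let $\mathcal S_{KL}$ be the closed-loop system, with input $w$, output $z$ and state $(x,\hat x)$, formed by the plant and the observer-based controller $$\dot{\hat x}=A\hat x+B_2u+L(\hat y-y),\qquad \hat y=C_1\hat x,\qquad u=K\hat x .$$ A real square matrix is called stable if all its eigenvalues have negative real part, and a system is called stable if its state matrix is. For $\alpha>0$ and a system $\mathcal S:\ \dot\xi=\bar A\xi+\bar Bw,\ z=\bar C\xi$ such that every eigenvalue $\mu$ of $\bar A$ satisfies $\alpha<-2\operatorname{Re}\mu$,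 the $\varepsilon(\alpha)$-norm of $\mathcal S$ is defined by $$\|\mathcal S\|_{\varepsilon(\alpha)}=\bigl(\operatorname{tr}(\bar C\,\bar P_\alpha\bar C^\top)\bigr)^{1/2},$$ where $\bar P_\alpha$ is the unique solution of $\bar A\bar P_\alpha+\bar P_\alpha\bar A^\top+\alpha\bar P_\alpha+\frac1\alpha\bar B\bar B^\top=0$. Fix $\alpha>0$, and let $Q_\alpha$ and $P_\alpha$ be (symmetric) positive definite solutions of $$Q_\alpha A+A^\top Q_\alpha+\alpha Q_\alpha-\alpha Q_\alpha B_2(D_2^\top D_2)^{-1}B_2^\top Q_\alpha+\tfrac1\alpha C_2^\top C_2=0,$$ $$AP_\alpha+P_\alpha A^\top+\alpha P_\alpha-\alpha P_\alpha C_1^\top(D_1D_1^\top)^{-1}C_1P_\alpha+\tfrac1\alpha B_1B_1^\top=0 .$$ Put $$K=-\alpha(D_2^\top D_2)^{-1}B_2^\top Q_\alpha,\qquad L=-\alpha P_\alpha C_1^\top(D_1D_1^\top)^{-1}.$$ Then $\mathcal S_{KL}$ is stable, its $\varepsilon(\alpha)$-norm is defined, and $$\|\mathcal S_{KL}\|_{\varepsilon(\alpha)}\le\|\mathcal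 S_{K'L'}\|_{\varepsilon(\alpha)}$$ for all $K'\in\mathbb R^{m\times n}$, $L'\in\mathbb R^{n\times k}$ for which the $\varepsilon(\alpha)$-norm of $\mathcal S_{K'L'}$ is defined. Moreover $$\begin{aligned}\|\mathcal S_{KL}\|_{\varepsilon(\alpha)}&=\bigl(\operatorname{tr}(B_1^\top Q_\alpha B_1)+\operatorname{tr}(D_2KP_\alpha K^\top D_2^\top)\bigr)^{1/2}\\&=\bigl(\operatorname{tr}(C_2P_\alpha C_2^\top)+\operatorname{tr}(D_1^\top L^\top Q_\alpha LD_1)\bigr)^{1/2}.\end{aligned}$$ -/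

import Mathlib

open scoped Matrix

/-- A real square matrix is stable if all its (complex) eigenvalues have strictly negative
real parts. -/
def Matrix.IsStableMatrix {ι : Type*} [Fintype ι] [DecidableEq ι] (A : Matrix ι ι ℝ) : Prop :=
  ∀ μ ∈ spectrum ℂ (A.map (algebraMap ℝ ℂ)), μ.re < 0

/-- `(A, B)` is stabilizable: some state feedback `u = K x` makes `A + B K` stable. -/
def IsStabilizable {ι κ : Type*} [Fintype ι] [DecidableEq ι] [Fintype κ]
    (A : Matrix ι ι ℝ) (B : Matrix ι κ ℝ) : Prop :=
  ∃ K : Matrix κ ι ℝ, (A + B * K).IsStableMatrix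

/-- `(C, A)` is detectable: some output injection `L` makes `A + L C` stable. -/
def IsDetectable {ι κ : Type*} [Fintype ι] [DecidableEq ι] [Fintype κ]
    (C : Matrix κ ι ℝ) (A : Matrix ι ι ℝ) : Prop :=
  ∃ L : Matrix ι κ ℝ, (A + L * C).IsStableMatrix

/-- `(A, B)` is (completely) controllable: every state is reachable from `x(0) = 0` in finite
time `T`, for `x' = A x + B u` with an integrable input `u`. The state at time `T` is written by
variation of constants. -/
def IsControllable {ι κ : Type*} [Fintype ι] [DecidableEq ι] [Fintype κ]
    (A : Matrix ι ι ℝ) (B : Matrix ι κ ℝ) : Prop :=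
  ∀ x : ι → ℝ, ∃ T : ℝ, 0 < T ∧ ∃ u : ℝ → κ → ℝ,
    IntervalIntegrable u MeasureTheory.volume 0 T ∧
      (∫ t in (0 : ℝ)..T, Matrix.mulVec (NormedSpace.exp ((T - t) • A)) (B.mulVec (u t))) = x

/-- `(C, A)` is (completely) observable: the only initial state for which the output
`y(t) = C exp(t A) x₀` of `x' = A x`, `y = C x` vanishes identically is `x₀ = 0`. -/
def IsObservable {ι κ : Type*} [Fintype ι] [DecidableEq ι]
    (C : Matrix κ ι ℝ) (A : Matrix ι ι ℝ) : Prop :=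
  ∀ x₀ : ι → ℝ,
    (∀ t : ℝ, 0 ≤ t → C.mulVec (Matrix.mulVec (NormedSpace.exp (t • A)) x₀) = 0) → x₀ = 0

/-- A strictly proper linear time-invariant system `x' = A x + B u`, `y = C x`, with states,
inputs and outputs indexed by `ι`, `κ` and `ο`. -/
structure LTISystem (ι κ ο : Type*) where
  A : Matrix ι ι ℝ
  B : Matrix ι κ ℝ
  C : Matrix ο ι ℝ

namespace LTISystem

variable {ι κ ο : Type*} [Fintype ι] [DecidableEq ι] [Fintype κ] [Fintype ο]

/-- The system is stable if its state matrix is. -/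
def IsStable (S : LTISystem ι κ ο) : Prop := S.A.IsStableMatrix

/-- The range of `α` for which the `ε(α)`-norm is defined: `α ∈ (0, -2 r)`, where `r < 0` is the
largest real part of an eigenvalue of `A`. -/
def EpsNormDefined (S : LTISystem ι κ ο) (α : ℝ) : Prop :=
  0 < α ∧ ∀ μ ∈ spectrum ℂ (S.A.map (algebraMap ℝ ℂ)), α < -2 * μ.re

/-- The shifted Lyapunov equation `A P + P Aᵀ + α P + α⁻¹ B Bᵀ = 0`. -/
def IsAlphaGramian (S : LTISystem ι κ ο) (α : ℝ) (P : Matrix ι ι ℝ) : Prop :=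
  S.A * P + P * S.Aᵀ + α • P + (1 / α) • (S.B * S.Bᵀ) = 0

open Classical in
/-- The solution `P_α` of the shifted Lyapunov equation. Whenever the `ε(α)`-norm is defined there
is exactly one solution, see `existsUnique_isAlphaGramian`. -/
noncomputable def alphaGramian (S : LTISystem ι κ ο) (α : ℝ) : Matrix ι ι ℝ :=
  if h : ∃ P, S.IsAlphaGramian α P then h.choose else 0

/-- The `ε(α)`-norm: `‖S‖² = trace (C P_α Cᵀ)`. It is meaningful if `S.EpsNormDefined α`. -/
noncomputable def epsNorm (S : LTISystem ι κ ο) (α : ℝ) : ℝ :=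
  Real.sqrt (S.C * S.alphaGramian α * S.Cᵀ).trace

theorem eq_zero_of_lyapunov {M X : Matrix ι ι ℂ} (hM : ∀ μ ∈ spectrum ℂ M, μ.re < 0)
    (h : M * X + X * Mᵀ = 0) : X = 0 := by
  have hMX : M * X = X * (-Mᵀ) := by
    rw [Matrix.mul_neg]; exact eq_neg_of_add_eq_zero_left h
  have hpow : ∀ k : ℕ, M ^ k * X = X * (-Mᵀ) ^ k := by
    intro k
    induction k with
    | zero => simp
    | succ k ih =>
      rw [pow_succ, Matrix.mul_assoc, hMX, ← Matrix.mul_assoc, ih, Matrix.mul_assoc, ← pow_succ]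
  have hpoly : ∀ p : Polynomial ℂ, Polynomial.aeval M p * X = X * Polynomial.aeval (-Mᵀ) p := by
    intro p
    induction p using Polynomial.induction_on' with
    | add p q hp hq => simp [Matrix.add_mul, Matrix.mul_add, hp, hq]
    | monomial k a =>
      simp only [Polynomial.aeval_monomial, Algebra.algebraMap_eq_smul_one,
        Matrix.mul_smul, smul_mul_assoc, one_mul]
      rw [hpow]
  have h0 : Polynomial.aeval M (-Mᵀ).charpoly * X = 0 := by
    rw [hpoly, Matrix.aeval_self_charpoly, Matrix.mul_zero]
  have hu : IsUnit (Polynomial.aeval M (-Mᵀ).charpoly) := by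
    rw [← spectrum.zero_notMem_iff ℂ]
    intro hz
    cases isEmpty_or_nonempty ι with
    | inl hι =>
      exact (spectrum.zero_notMem_iff ℂ).2 (isUnit_of_subsingleton _) hz
    | inr hι =>
      have : Nontrivial (Matrix ι ι ℂ) := inferInstance
      have hne : (spectrum ℂ M).Nonempty := spectrum.nonempty_of_isAlgClosed_of_finiteDimensional ℂ M
      rw [spectrum.map_polynomial_aeval_of_nonempty M _ hne] at hz
      obtain ⟨μ, hμ, hμ0⟩ := hz
      have h1 : μ ∈ spectrum ℂ (-Mᵀ) := by
        rw [Matrix.mem_spectrum_iff_isRoot_charpoly]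
        exact hμ0
      rw [← spectrum.neg_eq, Set.mem_neg] at h1
      have h2 : -μ ∈ spectrum ℂ M := by
        rw [Matrix.mem_spectrum_iff_isRoot_charpoly] at h1 ⊢
        rwa [Matrix.charpoly_transpose] at h1
      have := hM _ h2
      have := hM _ hμ
      simp at *
      linarith
  exact (hu.mul_right_eq_zero).1 h0

theorem existsUnique_isAlphaGramian (S : LTISystem ι κ ο) (α : ℝ) (h : S.EpsNormDefined α) :
    ∃! P, S.IsAlphaGramian α P := by
  let T : Matrix ι ι ℝ →ₗ[ℝ] Matrix ι ι ℝ :=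
    { toFun := fun P => S.A * P + P * S.Aᵀ + α • P
      map_add' := by intro P Q; simp only [Matrix.mul_add, Matrix.add_mul, smul_add]; abel
      map_smul' := by
        intro c P
        simp only [Matrix.mul_smul, Matrix.smul_mul, smul_add, RingHom.id_apply, smul_comm c α] }
  have hT : ∀ P, T P = S.A * P + P * S.Aᵀ + α • P := fun _ => rfl
  have hinj : Function.Injective T := by
    rw [← LinearMap.ker_eq_bot, LinearMap.ker_eq_bot']
    intro P hP
    rw [hT] at hP
    have key : P.map (algebraMap ℝ ℂ) = 0 := by
      refine eq_zero_of_lyapunov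
        (M := S.A.map (algebraMap ℝ ℂ) + algebraMap ℂ _ ((α / 2 : ℝ) : ℂ)) ?_ ?_
      · intro μ hμ
        rw [add_comm, ← sub_add_cancel μ (((α / 2 : ℝ) : ℂ)), spectrum.add_mem_add_iff] at hμ
        have := h.2 _ hμ
        simp at this
        linarith
      · have := congrArg (fun Z : Matrix ι ι ℝ => Z.map (algebraMap ℝ ℂ)) hP
        simp only [Matrix.map_add _ (map_add (algebraMap ℝ ℂ)), Matrix.map_mul,
          Matrix.map_zero _ (map_zero (algebraMap ℝ ℂ))] at this
        rw [← this]
        ext i j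
        simp [Algebra.algebraMap_eq_smul_one, Matrix.add_mul, Matrix.mul_add, Matrix.mul_apply,
          Matrix.transpose_apply]
        ring
    ext i j
    have := congrFun (congrFun key i) j
    simpa using this
  have hsurj : Function.Surjective T := LinearMap.injective_iff_surjective.1 hinj
  obtain ⟨P, hP⟩ := hsurj (-((1 / α) • (S.B * S.Bᵀ)))
  refine ⟨P, ?_, ?_⟩
  · change T P + _ = 0
    rw [hP, neg_add_cancel]
  · intro P' hP'
    apply hinj
    rw [hP]
    exact eq_neg_of_add_eq_zero_left hP'

end LTISystem

/-- The closed loop of the plant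
`x' = A x + B₁ w + B₂ u`, `y = C₁ x + D₁ w`, `z = C₂ x + D₂ u`
and the observer-based controller
`x̂' = A x̂ + B₂ u + L (ŷ - y)`, `ŷ = C₁ x̂`, `u = K x̂`,
as the system with input `w`, output `z` and state `(x, x̂)`. -/
def closedLoop {n m k p q : ℕ} (A : Matrix (Fin n) (Fin n) ℝ)
    (B₁ : Matrix (Fin n) (Fin p) ℝ) (B₂ : Matrix (Fin n) (Fin m) ℝ)
    (C₁ : Matrix (Fin k) (Fin n) ℝ) (C₂ : Matrix (Fin q) (Fin n) ℝ)
    (D₁ : Matrix (Fin k) (Fin p) ℝ) (D₂ : Matrix (Fin q) (Fin m) ℝ)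
    (K : Matrix (Fin m) (Fin n) ℝ) (L : Matrix (Fin n) (Fin k) ℝ) :
    LTISystem (Fin n ⊕ Fin n) (Fin p) (Fin q) where
  A := Matrix.fromBlocks A (B₂ * K) (-(L * C₁)) (A + B₂ * K + L * C₁)
  B := Matrix.fromRows B₁ (-(L * D₁))
  C := Matrix.fromCols C₂ (D₂ * K)

/-! Write `Π` for the `α`-Gramian of the closed loop with arbitrary gains `K'`, `L'`, and `F = D₂
[K, -K']`, `G = [L D₁; L' D₁]`. Two completions of squares drive the proof. The control Riccati
equation says that `diag(Q, 0)` satisfies the dual closed-loop Lyapunov equation up to the defect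
`(1/α) Fᵀ F`; pairing this with the equation of `Π` under the trace gives `tr(C Π Cᵀ) = tr(B₁ᵀ Q B₁)
+ tr(F Π Fᵀ)` (`LTISystem.trace_mul_of_isAlphaGramian`). The filter Riccati equation says that `E =
Π - diag(P, 0)` solves the closed-loop Lyapunov equation with forcing `(1/α) G Gᵀ`, so `E` is
positive semidefinite.

Since `F diag(P, 0) Fᵀ = D₂ K P Kᵀ D₂ᵀ`, the squared norm is a constant independent of `K'`, `L'`
plus `tr(F E Fᵀ) ≥ 0`. For the Riccati gains, `F = D₂ K J` with `J = [1, -1]`. The error map `J`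
annihilates `G` and intertwines the closed loop with `A + L C₁`, so `J E Jᵀ` solves a homogeneous
Lyapunov equation and vanishes; the bound is attained.

The norm is defined for these gains because the closed-loop spectrum lies in those of `A + B₂ K` and
`A + L C₁`. Each Riccati equation is a shifted Lyapunov equation for one of these matrices, and the
eigenvector forms of observability and controllability make the spectral bound strict
(`Matrix.re_lt_of_riccati`). -/

namespace Matrix

/-! ### Eigenvectors, transposes and shifts of the spectrum. -/

section Spectrum

variable {ι : Type*} [Fintype ι] [DecidableEq ι]

theorem mem_spectrum_iff_exists_mulVec {K : Type*} [Field K] {A : Matrix ι ι K} {μ : K} :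
    μ ∈ spectrum K A ↔ ∃ v, v ≠ 0 ∧ A *ᵥ v = μ • v := by
  rw [spectrum.mem_iff, isUnit_iff_isUnit_det, isUnit_iff_ne_zero, not_not,
    ← exists_mulVec_eq_zero_iff]
  refine exists_congr fun v => and_congr_right fun _ => ?_
  rw [sub_mulVec, sub_eq_zero, Algebra.algebraMap_eq_smul_one, smul_mulVec, one_mulVec, eq_comm]

theorem spectrum_transpose {K : Type*} [Field K] (A : Matrix ι ι K) :
    spectrum K Aᵀ = spectrum K A := by
  ext μ
  rw [mem_spectrum_iff_isRoot_charpoly, mem_spectrum_iff_isRoot_charpoly, charpoly_transpose]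

theorem mem_spectrum_add_algebraMap_iff {A : Matrix ι ι ℝ} {a : ℝ} {μ : ℂ} :
    μ ∈ spectrum ℂ ((A + a • (1 : Matrix ι ι ℝ)).map (algebraMap ℝ ℂ)) ↔
      μ - a ∈ spectrum ℂ (A.map (algebraMap ℝ ℂ)) := by
  have : (A + a • (1 : Matrix ι ι ℝ)).map (algebraMap ℝ ℂ) =
      algebraMap ℂ _ (a : ℂ) + A.map (algebraMap ℝ ℂ) := by
    ext i j
    by_cases hij : i = j <;> simp [Algebra.algebraMap_eq_smul_one, add_comm, hij]
  rw [this]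
  conv_lhs => rw [← sub_add_cancel μ (a : ℂ)]
  rw [spectrum.add_mem_add_iff]

end Spectrum

/-! ### Decay of matrix powers. -/

section Powers

open Filter Topology

/-- By Gelfand's formula, `‖a ^ n‖` is eventually at most `r ^ n` for any `r` strictly between the
spectral radius and `1`. -/
theorem tendsto_pow_zero_of_spectralRadius_lt_one {𝔸 : Type*} [NormedRing 𝔸] [NormedAlgebra ℂ 𝔸]
    [CompleteSpace 𝔸] {a : 𝔸} (ha : spectralRadius ℂ a < 1) :
    Tendsto (fun n : ℕ => a ^ n) atTop (𝓝 0) := by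
  obtain ⟨r, hr, hr1⟩ := ENNReal.lt_iff_exists_nnreal_btwn.1 ha
  have hr1' : r < 1 := by exact_mod_cast hr1
  have hlim := (spectrum.pow_nnnorm_pow_one_div_tendsto_nhds_spectralRadius a).eventually_lt_const hr
  refine squeeze_zero_norm' (a := fun n => (r : ℝ) ^ n) ?_
    (tendsto_pow_atTop_nhds_zero_of_lt_one r.2 (by exact_mod_cast hr1'))
  filter_upwards [hlim, eventually_gt_atTop 0] with n hn h0
  have h1 := ENNReal.rpow_le_rpow hn.le (Nat.cast_nonneg (α := ℝ) n)
  rw [← ENNReal.rpow_mul, one_div_mul_cancel (by positivity), ENNReal.rpow_one,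
    ENNReal.rpow_natCast] at h1
  exact_mod_cast h1

attribute [local instance] Matrix.linftyOpNormedRing Matrix.linftyOpNormedAlgebra

theorem tendsto_pow_zero_of_spectrum_norm_lt_one {ι : Type*} [Fintype ι] [DecidableEq ι]
    {F : Matrix ι ι ℝ} (hF : ∀ μ ∈ spectrum ℂ (F.map (algebraMap ℝ ℂ)), ‖μ‖ < 1) :
    Tendsto (fun n : ℕ => F ^ n) atTop (𝓝 0) := by
  cases isEmpty_or_nonempty ι with
  | inl h => exact tendsto_nhds_of_eventually_eq (Eventually.of_forall fun n => Subsingleton.elim _ _)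
  | inr h =>
    have : FiniteDimensional ℂ (Matrix ι ι ℂ) := inferInstance
    have : CompleteSpace (Matrix ι ι ℂ) := FiniteDimensional.complete ℂ _
    have hr : spectralRadius ℂ (F.map (algebraMap ℝ ℂ)) < 1 := by
      refine spectrum.spectralRadius_lt_of_forall_lt _ (r := 1) fun μ hμ => ?_
      exact_mod_cast hF μ hμ
    have h1 := tendsto_pow_zero_of_spectralRadius_lt_one hr
    have hre : Continuous fun Z : Matrix ι ι ℂ => Z.map Complex.re :=
      continuous_id.matrix_map Complex.continuous_re
    refine ((hre.tendsto 0).comp h1).congr' (Eventually.of_forall fun n => ?_) |>.trans_eq ?_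
    · have := map_pow (algebraMap ℝ ℂ).mapMatrix F n
      simp only [RingHom.mapMatrix_apply] at this
      ext i j
      simp only [Function.comp_apply, ← this]
      simp
    · simp

end Powers

/-! ### Positivity of solutions of Stein and Lyapunov equations. -/

section Lyapunov

open Filter Topology

variable {ι : Type*} [Fintype ι] [DecidableEq ι]

/-- Iterating the equation writes `X - F ^ k X (F ^ k)ᵀ` as a sum of congruences of `N`, and the
subtracted term tends to zero. -/
theorem posSemidef_of_stein {F X N : Matrix ι ι ℝ} (hF : Tendsto (fun n : ℕ => F ^ n) atTop (𝓝 0))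
    (hN : N.PosSemidef) (h : X = F * X * Fᵀ + N) : X.PosSemidef := by
  have hk : ∀ k : ℕ, (X - F ^ k * X * (F ^ k)ᵀ).PosSemidef := by
    intro k
    induction k with
    | zero => simpa using PosSemidef.zero
    | succ k ih =>
      have h1 := ih.add (hN.mul_mul_conjTranspose_same (F ^ k))
      rw [conjTranspose_eq_transpose_of_trivial] at h1
      convert h1 using 1
      conv_rhs => enter [1, 2, 1, 2]; rw [h]
      rw [pow_succ, transpose_mul]
      noncomm_ring
  have hlim : Tendsto (fun k : ℕ => X - F ^ k * X * (F ^ k)ᵀ) atTop (𝓝 X) := by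
    have hc : Continuous fun Z : Matrix ι ι ℝ => X - Z * X * Zᵀ := by fun_prop
    have := (hc.tendsto 0).comp hF
    simpa [Function.comp_def] using this
  -- Symmetry of `X` is not assumed; it is inherited from the approximants.
  have hH : X.IsHermitian := by
    have h1 : Tendsto (fun k : ℕ => (X - F ^ k * X * (F ^ k)ᵀ)ᴴ) atTop (𝓝 Xᴴ) :=
      (continuous_id.matrix_conjTranspose.tendsto X).comp hlim
    refine tendsto_nhds_unique h1 (hlim.congr fun k => ?_)
    exact (hk k).1.symm
  refine PosSemidef.of_dotProduct_mulVec_nonneg hH fun v => ?_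
  have hc : Continuous fun Z : Matrix ι ι ℝ => star v ⬝ᵥ Z *ᵥ v := by fun_prop
  exact ge_of_tendsto' ((hc.tendsto X).comp hlim) fun k => (hk k).dotProduct_mulVec_nonneg v

/-- The Cayley transform `(M - 1)⁻¹ (M + 1)` carries the open left half-plane into the open unit
disc and turns the Lyapunov equation into a Stein equation. -/
theorem posSemidef_of_lyapunov {M X N : Matrix ι ι ℝ} (hM : M.IsStableMatrix)
    (hN : N.PosSemidef) (h : M * X + X * Mᵀ + N = 0) : X.PosSemidef := by
  have hu : IsUnit (M - 1).det := by
    rw [isUnit_iff_ne_zero]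
    intro h0
    obtain ⟨v, hv, hv1⟩ := exists_mulVec_eq_zero_iff.2 h0
    have h2 : (1 : ℂ) ∈ spectrum ℂ (M.map (algebraMap ℝ ℂ)) := by
      refine mem_spectrum_iff_exists_mulVec.2 ⟨fun i => (v i : ℂ), ?_, ?_⟩
      · intro hv0
        exact hv (funext fun i => by simpa using congrFun hv0 i)
      · rw [sub_mulVec, one_mulVec, sub_eq_zero] at hv1
        ext i
        have := congrArg (algebraMap ℝ ℂ) (congrFun hv1 i)
        simpa [mulVec, dotProduct] using this
    have := hM 1 h2
    norm_num at this
  set R := (M - 1)⁻¹ with hR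
  have hR1 : R * (M - 1) = 1 := nonsing_inv_mul _ hu
  have hR2 : (M - 1) * R = 1 := mul_nonsing_inv _ hu
  refine posSemidef_of_stein (F := R * (M + 1)) (N := (2 : ℝ) • (R * N * Rᵀ)) ?_ ?_ ?_
  · apply tendsto_pow_zero_of_spectrum_norm_lt_one
    intro μ hμ
    obtain ⟨v, hv, hv1⟩ := mem_spectrum_iff_exists_mulVec.1 hμ
    have e1 : (M.map (algebraMap ℝ ℂ) - 1) * (R * (M + 1)).map (algebraMap ℝ ℂ) =
        M.map (algebraMap ℝ ℂ) + 1 := by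
      have : (M - 1) * (R * (M + 1)) = M + 1 := by rw [← Matrix.mul_assoc, hR2, Matrix.one_mul]
      have := congrArg (algebraMap ℝ ℂ).mapMatrix this
      rwa [map_mul, map_sub, map_add, map_one] at this
    have e2 : (1 - μ) • (M.map (algebraMap ℝ ℂ) *ᵥ v) = (-(1 + μ)) • v := by
      have := congrArg (fun Z => Z *ᵥ v) e1
      simp only [← mulVec_mulVec, hv1, mulVec_smul, sub_mulVec, add_mulVec, one_mulVec,
        smul_sub] at this
      rw [sub_smul, one_smul, neg_smul, add_smul, one_smul]
      linear_combination (exp := 1) -this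
    have hμ1 : (1 - μ) ≠ 0 := by
      intro h0
      rw [h0, zero_smul] at e2
      have : -(1 + μ) = 0 := by
        rcases smul_eq_zero.1 e2.symm with h | h
        · exact h
        · exact absurd h hv
      have : (2 : ℂ) = 0 := by linear_combination h0 - this
      norm_num at this
    -- The inverse Cayley transform of `μ` is an eigenvalue of `M`; its real part is `(|μ|² - 1) /
    -- |1 - μ|²`, so its negativity means `|μ| < 1`.
    have e3 : -(1 + μ) / (1 - μ) ∈ spectrum ℂ (M.map (algebraMap ℝ ℂ)) := by
      refine mem_spectrum_iff_exists_mulVec.2 ⟨v, hv, ?_⟩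
      rw [div_eq_inv_mul, mul_smul, ← e2, smul_smul, inv_mul_cancel₀ hμ1, one_smul]
    have e4 := hM _ e3
    have hpos : 0 < Complex.normSq (1 - μ) := Complex.normSq_pos.2 hμ1
    rw [Complex.div_re, ← add_div, div_lt_iff₀ hpos, zero_mul] at e4
    simp at e4
    rw [← sq_lt_one_iff₀ (norm_nonneg _), Complex.sq_norm, Complex.normSq_apply]
    nlinarith
  · have := (hN.mul_mul_conjTranspose_same R).smul (zero_le_two (α := ℝ))
    rwa [conjTranspose_eq_transpose_of_trivial] at this
  · have hRt : (M - 1)ᵀ * Rᵀ = 1 := by rw [← transpose_mul, hR1, transpose_one]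
    have key : (M - 1) * X * (M - 1)ᵀ = (M + 1) * X * (M + 1)ᵀ + (2 : ℝ) • N := by
      have : N = -(M * X + X * Mᵀ) := (neg_eq_of_add_eq_zero_right h).symm
      rw [this, two_smul]
      simp only [transpose_sub, transpose_add, transpose_one]
      noncomm_ring
    calc X = R * ((M - 1) * X * (M - 1)ᵀ) * Rᵀ := by
            rw [Matrix.mul_assoc R, Matrix.mul_assoc ((M - 1) * X), hRt, Matrix.mul_one,
              ← Matrix.mul_assoc, hR1, Matrix.one_mul]
      _ = _ := by
            rw [key, transpose_mul]
            simp only [Matrix.mul_add, Matrix.add_mul, Matrix.mul_smul, Matrix.smul_mul,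
              Matrix.mul_assoc]

end Lyapunov

end Matrix

/-! ### Observability and controllability tested on eigenvectors. -/

section Modes

variable {ι κ : Type*} [Fintype ι]

open Matrix

theorem Matrix.re_map_mulVec {ο : Type*} (M : Matrix ο ι ℝ) (v : ι → ℂ) (i : ο) :
    ((M.map (algebraMap ℝ ℂ) *ᵥ v) i).re = (M *ᵥ fun j => (v j).re) i := by
  simp [mulVec, dotProduct]

/-- Eigenspaces are stable under multiplication by `I`, so it is enough to kill real parts of
eigenvectors. -/
theorem Complex.vec_eq_zero_of_re {σ : Type*} {v : σ → ℂ} (h : (fun j => (v j).re) = 0)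
    (h' : (fun j => ((Complex.I • v) j).re) = 0) : v = 0 := by
  ext j
  apply Complex.ext
  · simpa using congrFun h j
  · simpa using congrFun h' j

theorem Matrix.im_map_mulVec {ο : Type*} (M : Matrix ο ι ℝ) (v : ι → ℂ) (i : ο) :
    ((M.map (algebraMap ℝ ℂ) *ᵥ v) i).im = (M *ᵥ fun j => (v j).im) i := by
  simp [mulVec, dotProduct]

variable [DecidableEq ι]

/-- A finite-dimensional subspace is closed, so it contains the sum of the exponential series. -/
theorem Matrix.exp_mem_of_pow_mem {A : Matrix ι ι ℝ} (W : Submodule ℝ (Matrix ι ι ℝ))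
    (hW : ∀ k : ℕ, A ^ k ∈ W) (t : ℝ) : NormedSpace.exp (t • A) ∈ W := by
  rw [NormedSpace.exp_eq_tsum ℝ]
  refine tsum_mem W.closed_of_finiteDimensional fun k => W.smul_mem _ ?_
  rw [smul_pow]
  exact W.smul_mem _ (hW k)

theorem Matrix.pow_mulVec_of_mulVec_eq_smul {R : Type*} [CommRing R] {M : Matrix ι ι R} {v : ι → R}
    {μ : R} (h : M *ᵥ v = μ • v) (k : ℕ) : M ^ k *ᵥ v = μ ^ k • v := by
  induction k with
  | zero => simp
  | succ k ih => rw [pow_succ, ← mulVec_mulVec, h, mulVec_smul, ih, smul_smul, pow_succ']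

/-- A complex eigenvector in the kernel of `C` has a real part that is invisible along all powers
of `A`. -/
theorem Matrix.mul_pow_mulVec_re_eq_zero {ο : Type*} {A : Matrix ι ι ℝ} {C : Matrix ο ι ℝ}
    {v : ι → ℂ} {μ : ℂ} (hA : A.map (algebraMap ℝ ℂ) *ᵥ v = μ • v)
    (hC : C.map (algebraMap ℝ ℂ) *ᵥ v = 0) (k : ℕ) :
    C *ᵥ (A ^ k *ᵥ fun j => (v j).re) = 0 := by
  have hpow : (A ^ k).map (algebraMap ℝ ℂ) *ᵥ v = μ ^ k • v := by
    have := map_pow (algebraMap ℝ ℂ).mapMatrix A k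
    simp only [RingHom.mapMatrix_apply] at this
    rw [this, pow_mulVec_of_mulVec_eq_smul hA]
  ext i
  rw [mulVec_mulVec, ← re_map_mulVec, Matrix.map_mul, ← mulVec_mulVec, hpow, mulVec_smul, hC]
  simp

theorem IsObservable.eq_zero_of_eigenvector {ο : Type*} {A : Matrix ι ι ℝ} {C : Matrix ο ι ℝ}
    (h : IsObservable C A) {v : ι → ℂ} {μ : ℂ} (hA : A.map (algebraMap ℝ ℂ) *ᵥ v = μ • v)
    (hC : C.map (algebraMap ℝ ℂ) *ᵥ v = 0) : v = 0 := by
  have key : ∀ w : ι → ℂ, A.map (algebraMap ℝ ℂ) *ᵥ w = μ • w → C.map (algebraMap ℝ ℂ) *ᵥ w = 0 →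
      (fun j => (w j).re) = 0 := by
    intro w hw hCw
    refine h _ fun t _ => ?_
    let W : Submodule ℝ (Matrix ι ι ℝ) :=
      { carrier := {Z | C *ᵥ (Z *ᵥ fun j => (w j).re) = 0}
        add_mem' := by
          intro a b ha hb
          simp only [Set.mem_ofPred_eq] at *
          rw [add_mulVec, mulVec_add, ha, hb, add_zero]
        zero_mem' := by simp
        smul_mem' := by
          intro c a ha
          simp only [Set.mem_ofPred_eq] at *
          rw [smul_mulVec, mulVec_smul, ha, smul_zero] }
    exact exp_mem_of_pow_mem W (mul_pow_mulVec_re_eq_zero hw hCw) t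
  refine Complex.vec_eq_zero_of_re (key v hA hC) (key _ ?_ ?_)
  · rw [mulVec_smul, hA, smul_comm]
  · rw [mulVec_smul, hC, smul_zero]

/-- The real part `r` of a left eigenvector killed by `B` is orthogonal to every reachable state. As
`r` itself is reachable, `r ⬝ᵥ r = 0`. -/
theorem IsControllable.eq_zero_of_eigenvector [Fintype κ] {A : Matrix ι ι ℝ} {B : Matrix ι κ ℝ}
    (h : IsControllable A B) {v : ι → ℂ} {μ : ℂ} (hA : Aᵀ.map (algebraMap ℝ ℂ) *ᵥ v = μ • v)
    (hB : Bᵀ.map (algebraMap ℝ ℂ) *ᵥ v = 0) : v = 0 := by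
  have key : ∀ w : ι → ℂ, Aᵀ.map (algebraMap ℝ ℂ) *ᵥ w = μ • w →
      Bᵀ.map (algebraMap ℝ ℂ) *ᵥ w = 0 → (fun j => (w j).re) = 0 := by
    intro w hw hBw
    set r : ι → ℝ := fun j => (w j).re with hr
    let W : Submodule ℝ (Matrix ι ι ℝ) :=
      { carrier := {Z | r ᵥ* Z ᵥ* B = 0}
        add_mem' := by
          intro a b ha hb
          simp only [Set.mem_ofPred_eq] at *
          rw [vecMul_add, add_vecMul, ha, hb, add_zero]
        zero_mem' := by simp
        smul_mem' := by
          intro c a ha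
          simp only [Set.mem_ofPred_eq] at *
          rw [vecMul_smul, smul_vecMul, ha, smul_zero] }
    have hexp : ∀ s : ℝ, r ᵥ* NormedSpace.exp (s • A) ᵥ* B = 0 := by
      refine exp_mem_of_pow_mem W fun k => ?_
      have := mul_pow_mulVec_re_eq_zero hw hBw k
      rwa [← transpose_pow, mulVec_transpose, mulVec_transpose] at this
    obtain ⟨T, -, u, -, hx⟩ := h r
    have h0 : r ⬝ᵥ r = 0 := by
      nth_rewrite 2 [← hx]
      let f : (ι → ℝ) →L[ℝ] ℝ := LinearMap.toContinuousLinearMap (dotProductBilin ℝ ℝ r)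
      have hf : ∀ x, f x = r ⬝ᵥ x := fun _ => rfl
      by_cases hi : IntervalIntegrable
        (fun t => NormedSpace.exp ((T - t) • A) *ᵥ (B *ᵥ u t)) MeasureTheory.volume 0 T
      · rw [← hf, ← f.intervalIntegral_comp_comm hi]
        simp only [hf, dotProduct_mulVec, hexp, zero_dotProduct, intervalIntegral.integral_zero]
      -- The integral of a non-integrable function is `0` by convention, which gives the same
      -- conclusion.
      · rw [intervalIntegral.integral_undef hi, dotProduct_zero]
    exact dotProduct_self_eq_zero.1 h0
  refine Complex.vec_eq_zero_of_re (key v hA hB) (key _ ?_ ?_)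
  · rw [mulVec_smul, hA, smul_comm]
  · rw [mulVec_smul, hB, smul_zero]

end Modes

open Matrix

/-! ### Lyapunov equations shifted by `α`. -/

section ShiftedLyapunov

variable {ι ο : Type*} [Fintype ι] [DecidableEq ι] [Fintype ο]

/-- Evaluated on an eigenvector, the equation reads `(2 Re μ + α) v* Q v + (1/α) ‖H v‖² = 0`. If `2
Re μ + α ≥ 0`, then `H v = 0`, which `hker` excludes. The proof uses real and imaginary parts `a`,
`b`. -/
theorem Matrix.re_lt_of_lyapunov {M Q : Matrix ι ι ℝ} {H : Matrix ο ι ℝ} {α : ℝ} (hα : 0 < α)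
    (hQ : Q.PosDef) (h : Q * M + Mᵀ * Q + α • Q + (1 / α) • (Hᵀ * H) = 0)
    (hker : ∀ (μ : ℂ) (v : ι → ℂ), M.map (algebraMap ℝ ℂ) *ᵥ v = μ • v →
      H.map (algebraMap ℝ ℂ) *ᵥ v = 0 → v = 0) :
    ∀ μ ∈ spectrum ℂ (M.map (algebraMap ℝ ℂ)), α < -2 * μ.re := by
  intro μ hμ
  obtain ⟨v, hv, hMv⟩ := mem_spectrum_iff_exists_mulVec.1 hμ
  by_contra hcon
  refine hv (hker μ v hMv ?_)
  set a : ι → ℝ := fun j => (v j).re with ha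
  set b : ι → ℝ := fun j => (v j).im with hb
  have hMa : M *ᵥ a = μ.re • a - μ.im • b := by
    ext i
    rw [← re_map_mulVec, hMv]
    simp [ha, hb]
  have hMb : M *ᵥ b = μ.im • a + μ.re • b := by
    ext i
    have := congrArg Complex.im (congrFun hMv i)
    rw [im_map_mulVec] at this
    rw [this]
    simp [ha, hb]
    ring
  have hQs : ∀ x y : ι → ℝ, x ⬝ᵥ Q *ᵥ y = y ⬝ᵥ Q *ᵥ x := by
    intro x y
    have : Qᵀ = Q := (conjTranspose_eq_transpose_of_trivial Q).symm.trans hQ.1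
    rw [dotProduct_mulVec, ← mulVec_transpose, this, dotProduct_comm]
  have hquad : ∀ x : ι → ℝ, 2 * (x ⬝ᵥ Q *ᵥ (M *ᵥ x)) + α * (x ⬝ᵥ Q *ᵥ x) +
      1 / α * (H *ᵥ x ⬝ᵥ H *ᵥ x) = 0 := by
    intro x
    have h1 := congrArg (fun Z => x ⬝ᵥ Z *ᵥ x) h
    simp only [add_mulVec, smul_mulVec, dotProduct_add, dotProduct_smul, ← mulVec_mulVec,
      zero_mulVec, dotProduct_zero, smul_eq_mul] at h1
    have h2 : x ⬝ᵥ Mᵀ *ᵥ (Q *ᵥ x) = x ⬝ᵥ Q *ᵥ (M *ᵥ x) := by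
      rw [dotProduct_mulVec, vecMul_transpose, hQs]
    have h3 : x ⬝ᵥ Hᵀ *ᵥ (H *ᵥ x) = H *ᵥ x ⬝ᵥ H *ᵥ x := by
      rw [dotProduct_mulVec, vecMul_transpose]
    rw [h2, h3] at h1
    linarith
  have hqa := hquad a
  have hqb := hquad b
  rw [hMa] at hqa
  rw [hMb] at hqb
  simp only [mulVec_add, mulVec_sub, mulVec_smul, dotProduct_add, dotProduct_sub, dotProduct_smul,
    smul_eq_mul] at hqa hqb
  rw [hQs b a] at hqb
  have ha0 : 0 ≤ a ⬝ᵥ Q *ᵥ a := by simpa using hQ.posSemidef.dotProduct_mulVec_nonneg a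
  have hb0 : 0 ≤ b ⬝ᵥ Q *ᵥ b := by simpa using hQ.posSemidef.dotProduct_mulVec_nonneg b
  have hHa : 0 ≤ H *ᵥ a ⬝ᵥ H *ᵥ a := by simpa using dotProduct_star_self_nonneg (H *ᵥ a)
  have hHb : 0 ≤ H *ᵥ b ⬝ᵥ H *ᵥ b := by simpa using dotProduct_star_self_nonneg (H *ᵥ b)
  -- Adding the quadratic identities for `a` and `b` cancels the cross terms in `μ.im`.
  have hsum : 1 / α * (H *ᵥ a ⬝ᵥ H *ᵥ a + H *ᵥ b ⬝ᵥ H *ᵥ b) ≤ 0 := by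
    have : 0 ≤ (2 * μ.re + α) * (a ⬝ᵥ Q *ᵥ a + b ⬝ᵥ Q *ᵥ b) :=
      mul_nonneg (by linarith) (add_nonneg ha0 hb0)
    linarith
  have hsum' : H *ᵥ a ⬝ᵥ H *ᵥ a + H *ᵥ b ⬝ᵥ H *ᵥ b ≤ 0 :=
    nonpos_of_mul_nonpos_right hsum (by positivity)
  have hHa0 : H *ᵥ a = 0 := dotProduct_self_eq_zero.1 (by linarith)
  have hHb0 : H *ᵥ b = 0 := dotProduct_self_eq_zero.1 (by linarith)
  ext i
  apply Complex.ext
  · rw [re_map_mulVec]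
    exact congrFun hHa0 i
  · rw [im_map_mulVec]
    exact congrFun hHb0 i

theorem Matrix.posSemidef_of_shifted_lyapunov {M X N : Matrix ι ι ℝ} {α : ℝ}
    (hM : ∀ μ ∈ spectrum ℂ (M.map (algebraMap ℝ ℂ)), α < -2 * μ.re)
    (hN : N.PosSemidef) (h : M * X + X * Mᵀ + α • X + N = 0) : X.PosSemidef := by
  -- Replacing `M` by `M + (α / 2) 1` absorbs the term `α X`.
  refine posSemidef_of_lyapunov (M := M + (α / 2) • (1 : Matrix ι ι ℝ)) (N := N) ?_ hN ?_
  · intro μ hμ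
    have := hM _ (mem_spectrum_add_algebraMap_iff.1 hμ)
    simp at this
    linarith
  · rw [← h]
    simp only [transpose_add, transpose_smul, transpose_one, Matrix.add_mul, Matrix.mul_add,
      Matrix.smul_mul, Matrix.mul_smul, Matrix.one_mul, Matrix.mul_one]
    module

theorem Matrix.eq_zero_of_shifted_lyapunov {M X : Matrix ι ι ℝ} {α : ℝ} (hα : 0 < α)
    (hM : ∀ μ ∈ spectrum ℂ (M.map (algebraMap ℝ ℂ)), α < -2 * μ.re)
    (h : M * X + X * Mᵀ + α • X = 0) : X = 0 := by
  -- Without inputs the Gramian equation is homogeneous, so uniqueness identifies `X` with the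
  -- solution `0`.
  let S : LTISystem ι (Fin 0) (Fin 0) := ⟨M, 0, 0⟩
  refine (S.existsUnique_isAlphaGramian α ⟨hα, hM⟩).unique ?_ ?_
  · simpa [LTISystem.IsAlphaGramian, S] using h
  · simp [LTISystem.IsAlphaGramian, S]

theorem LTISystem.isAlphaGramian_alphaGramian {κ : Type*} [Fintype κ] (S : LTISystem ι κ ο) {α : ℝ}
    (h : S.EpsNormDefined α) : S.IsAlphaGramian α (S.alphaGramian α) := by
  have hex := (S.existsUnique_isAlphaGramian α h).exists
  rw [alphaGramian, dif_pos hex]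
  exact hex.choose_spec

end ShiftedLyapunov

/-! ### Spectrum and completion of squares for the closed loop. -/

section ClosedLoop

variable {n m k p q : ℕ} {A : Matrix (Fin n) (Fin n) ℝ}
  {B₁ : Matrix (Fin n) (Fin p) ℝ} {B₂ : Matrix (Fin n) (Fin m) ℝ}
  {C₁ : Matrix (Fin k) (Fin n) ℝ} {C₂ : Matrix (Fin q) (Fin n) ℝ}
  {D₁ : Matrix (Fin k) (Fin p) ℝ} {D₂ : Matrix (Fin q) (Fin m) ℝ}
  {K : Matrix (Fin m) (Fin n) ℝ} {L : Matrix (Fin n) (Fin k) ℝ}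
  {Q P : Matrix (Fin n) (Fin n) ℝ} {α : ℝ}

/-- Separation principle: the error `x - x̂` evolves by `A + L C₁`. An eigenvector with nonzero
error gives an eigenvector of that matrix; with zero error, its two equal halves are an eigenvector
of `A + B₂ K`. -/
theorem spectrum_closedLoop_subset :
    spectrum ℂ ((closedLoop A B₁ B₂ C₁ C₂ D₁ D₂ K L).A.map (algebraMap ℝ ℂ)) ⊆
      spectrum ℂ ((A + B₂ * K).map (algebraMap ℝ ℂ)) ∪
        spectrum ℂ ((A + L * C₁).map (algebraMap ℝ ℂ)) := by
  intro μ hμ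
  obtain ⟨v, hv, hAv⟩ := mem_spectrum_iff_exists_mulVec.1 hμ
  set x : Fin n → ℂ := v ∘ Sum.inl with hx
  set y : Fin n → ℂ := v ∘ Sum.inr with hy
  have hmap : ∀ X Y : Matrix (Fin n) (Fin n) ℝ, (X + Y).map (algebraMap ℝ ℂ) =
      X.map (algebraMap ℝ ℂ) + Y.map (algebraMap ℝ ℂ) := Matrix.map_add _ (map_add _)
  have hneg : ∀ X : Matrix (Fin n) (Fin n) ℝ, (-X).map (algebraMap ℝ ℂ) =
      -X.map (algebraMap ℝ ℂ) := fun X => by ext; simp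
  simp only [closedLoop, fromBlocks_map, fromBlocks_mulVec] at hAv
  have h1 := congrArg (fun f => f ∘ Sum.inl) hAv
  have h2 := congrArg (fun f => f ∘ Sum.inr) hAv
  simp only [Sum.elim_comp_inl, Sum.elim_comp_inr, ← hx, ← hy, hmap, hneg, add_mulVec,
    neg_mulVec] at h1 h2
  replace h1 : A.map (algebraMap ℝ ℂ) *ᵥ x + (B₂ * K).map (algebraMap ℝ ℂ) *ᵥ y = μ • x := h1
  replace h2 : -((L * C₁).map (algebraMap ℝ ℂ) *ᵥ x) + (A.map (algebraMap ℝ ℂ) *ᵥ y +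
    (B₂ * K).map (algebraMap ℝ ℂ) *ᵥ y + (L * C₁).map (algebraMap ℝ ℂ) *ᵥ y) = μ • y := h2
  by_cases hxy : x - y = 0
  · left
    rw [sub_eq_zero] at hxy
    refine mem_spectrum_iff_exists_mulVec.2 ⟨y, ?_, ?_⟩
    · intro h0
      refine hv (funext fun i => ?_)
      rcases i with i | i
      · exact congrFun (hxy.trans h0) i
      · exact congrFun h0 i
    · rw [hmap, add_mulVec, ← hxy]
      rw [← hxy] at h1
      exact h1
  · right
    refine mem_spectrum_iff_exists_mulVec.2 ⟨x - y, hxy, ?_⟩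
    rw [hmap, add_mulVec, mulVec_sub, mulVec_sub, smul_sub, ← h1, ← h2]
    abel

/-- Subtracting the optimal error covariance from the Gramian of the closed loop leaves the Gramian
of the innovation. -/
theorem lyapunov_closedLoop_fromBlocks (hα : α ≠ 0) (K' : Matrix (Fin m) (Fin n) ℝ)
    (L' : Matrix (Fin n) (Fin k) ℝ) (hPt : Pᵀ = P) (hBD : B₁ * D₁ᵀ = 0)
    (hL : L * D₁ * D₁ᵀ = -(α • (P * C₁ᵀ)))
    (hric : A * P + P * Aᵀ + α • P - (1 / α) • (L * D₁ * D₁ᵀ * Lᵀ) + (1 / α) • (B₁ * B₁ᵀ) = 0) :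
    (closedLoop A B₁ B₂ C₁ C₂ D₁ D₂ K' L').A * fromBlocks P 0 0 0 +
      fromBlocks P 0 0 0 * (closedLoop A B₁ B₂ C₁ C₂ D₁ D₂ K' L').Aᵀ + α • fromBlocks P 0 0 0 +
      (1 / α) • ((closedLoop A B₁ B₂ C₁ C₂ D₁ D₂ K' L').B *
        (closedLoop A B₁ B₂ C₁ C₂ D₁ D₂ K' L').Bᵀ) =
    (1 / α) • (fromRows (L * D₁) (L' * D₁) * (fromRows (L * D₁) (L' * D₁))ᵀ) := by
  have hDB : D₁ * B₁ᵀ = 0 := by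
    have := congrArg transpose hBD
    simpa using this
  have hL' : D₁ * (D₁ᵀ * Lᵀ) = -(α • (C₁ * P)) := by
    have := congrArg transpose hL
    simpa [transpose_mul, hPt, Matrix.mul_assoc] using this
  have hPL : P * C₁ᵀ = -((1 / α) • (L * D₁ * D₁ᵀ)) := by
    rw [hL, smul_neg, neg_neg, smul_smul, one_div_mul_cancel hα, one_smul]
  have hCP : C₁ * P = -((1 / α) • (D₁ * (D₁ᵀ * Lᵀ))) := by
    rw [hL', smul_neg, neg_neg, smul_smul, one_div_mul_cancel hα, one_smul]
  simp only [closedLoop, transpose_fromRows, fromRows_mul_fromCols, fromBlocks_transpose,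
    fromBlocks_multiply, fromBlocks_smul, fromBlocks_add, transpose_mul, transpose_neg]
  congr 1
  · refine sub_eq_zero.1 (Eq.trans ?_ hric)
    simp only [Matrix.mul_zero, Matrix.zero_mul, add_zero, Matrix.mul_assoc]
    abel
  · have e : P * (C₁ᵀ * L'ᵀ) = -((1 / α) • (L * D₁ * D₁ᵀ * L'ᵀ)) := by
      rw [← Matrix.mul_assoc, hPL, Matrix.neg_mul, Matrix.smul_mul]
    have e' : B₁ * (D₁ᵀ * L'ᵀ) = 0 := by rw [← Matrix.mul_assoc, hBD, Matrix.zero_mul]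
    simp [e, e', Matrix.mul_assoc]
  · have e' : D₁ * B₁ᵀ = 0 := hDB
    simp [Matrix.mul_assoc, hCP, e']
  · simp [Matrix.mul_assoc]

/-- Completion of squares for the closed loop, with the solution of the control Riccati equation. -/
theorem dual_lyapunov_closedLoop_fromBlocks (hα : α ≠ 0) (K' : Matrix (Fin m) (Fin n) ℝ)
    (L' : Matrix (Fin n) (Fin k) ℝ) (hQt : Qᵀ = Q) (hCD : C₂ᵀ * D₂ = 0)
    (hK : Kᵀ * D₂ᵀ * D₂ = -(α • (Q * B₂)))
    (hric : Q * A + Aᵀ * Q + α • Q - (1 / α) • (Kᵀ * D₂ᵀ * D₂ * K) + (1 / α) • (C₂ᵀ * C₂) = 0) :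
    (closedLoop A B₁ B₂ C₁ C₂ D₁ D₂ K' L').Aᵀ * fromBlocks Q 0 0 0 +
      fromBlocks Q 0 0 0 * (closedLoop A B₁ B₂ C₁ C₂ D₁ D₂ K' L').A + α • fromBlocks Q 0 0 0 +
      (1 / α) • ((closedLoop A B₁ B₂ C₁ C₂ D₁ D₂ K' L').Cᵀ *
        (closedLoop A B₁ B₂ C₁ C₂ D₁ D₂ K' L').C) =
    (1 / α) • ((D₂ * fromCols K (-K'))ᵀ * (D₂ * fromCols K (-K'))) := by
  have hDC : D₂ᵀ * C₂ = 0 := by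
    have := congrArg transpose hCD
    simpa using this
  have hK' : D₂ᵀ * (D₂ * K) = -(α • (B₂ᵀ * Q)) := by
    have := congrArg transpose hK
    simpa [transpose_mul, hQt, Matrix.mul_assoc] using this
  have hQB : Q * B₂ = -((1 / α) • (Kᵀ * D₂ᵀ * D₂)) := by
    rw [hK, smul_neg, neg_neg, smul_smul, one_div_mul_cancel hα, one_smul]
  have hBQ : B₂ᵀ * Q = -((1 / α) • (D₂ᵀ * (D₂ * K))) := by
    rw [hK', smul_neg, neg_neg, smul_smul, one_div_mul_cancel hα, one_smul]
  have hF : D₂ * fromCols K (-K') = fromCols (D₂ * K) (-(D₂ * K')) := by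
    rw [mul_fromCols, Matrix.mul_neg]
  simp only [hF, closedLoop, transpose_fromCols, fromRows_mul_fromCols,
    fromBlocks_transpose, fromBlocks_multiply, fromBlocks_smul, fromBlocks_add, transpose_mul,
    transpose_neg]
  congr 1
  · refine sub_eq_zero.1 (Eq.trans ?_ hric)
    simp only [Matrix.mul_zero, Matrix.zero_mul, add_zero, Matrix.mul_assoc]
    abel
  · have e : Q * (B₂ * K') = -((1 / α) • (Kᵀ * D₂ᵀ * D₂ * K')) := by
      rw [← Matrix.mul_assoc, hQB, Matrix.neg_mul, Matrix.smul_mul]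
    have e' : C₂ᵀ * (D₂ * K') = 0 := by rw [← Matrix.mul_assoc, hCD, Matrix.zero_mul]
    simp [e, e', Matrix.mul_assoc]
  · simp [Matrix.mul_assoc, hBQ, hDC]
  · simp [Matrix.mul_assoc]

end ClosedLoop

/-- Pair the first equation with `T` and the second with `X` under the trace: the terms linear in
both agree, leaving only the input, output and defect terms. -/
theorem LTISystem.trace_mul_of_isAlphaGramian {ι κ ο σ : Type*} [Fintype ι] [DecidableEq ι]
    [Fintype κ] [Fintype ο] [Fintype σ] {S : LTISystem ι κ ο} {α : ℝ} (hα : α ≠ 0)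
    {X T : Matrix ι ι ℝ} {F : Matrix σ ι ℝ} (hX : S.IsAlphaGramian α X)
    (hT : S.Aᵀ * T + T * S.A + α • T + (1 / α) • (S.Cᵀ * S.C) = (1 / α) • (Fᵀ * F)) :
    (S.C * X * S.Cᵀ).trace = (S.Bᵀ * T * S.B).trace + (F * X * Fᵀ).trace := by
  have h1 := congrArg (fun Z => (T * Z).trace) hX
  have h2 := congrArg (fun Z => (X * Z).trace) hT
  simp only [Matrix.mul_add, Matrix.mul_smul, trace_add, trace_smul, smul_eq_mul, Matrix.mul_zero,
    trace_zero] at h1 h2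
  have e1 : (T * (S.A * X)).trace = (X * (T * S.A)).trace := by
    rw [← Matrix.mul_assoc, trace_mul_comm]
  have e2 : (T * (X * S.Aᵀ)).trace = (X * (S.Aᵀ * T)).trace := by
    rw [trace_mul_comm, Matrix.mul_assoc]
  have e3 : (T * (S.B * S.Bᵀ)).trace = (S.Bᵀ * T * S.B).trace := by
    rw [← Matrix.mul_assoc, trace_mul_comm, Matrix.mul_assoc]
  have e4 : (X * (S.Cᵀ * S.C)).trace = (S.C * X * S.Cᵀ).trace := by
    rw [← Matrix.mul_assoc, trace_mul_comm, Matrix.mul_assoc]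
  have e5 : (X * (Fᵀ * F)).trace = (F * X * Fᵀ).trace := by
    rw [← Matrix.mul_assoc, trace_mul_comm, Matrix.mul_assoc]
  rw [e1, e2, e3, trace_mul_comm T X] at h1
  rw [e4, e5] at h2
  have h3 : 1 / α * (S.C * X * S.Cᵀ).trace =
      1 / α * ((S.Bᵀ * T * S.B).trace + (F * X * Fᵀ).trace) := by linarith
  exact mul_left_cancel₀ (one_div_ne_zero hα) h3

/-! ### Spectral bound from a Riccati equation. -/

section Riccati

variable {ι κ ο : Type*} [Fintype ι] [DecidableEq ι] [Fintype κ] [DecidableEq κ] [Fintype ο]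
  {A Q : Matrix ι ι ℝ} {B : Matrix ι κ ℝ} {C : Matrix ο ι ℝ} {D : Matrix ο κ ℝ} {K : Matrix κ ι ℝ}
  {α : ℝ}

/-- The Riccati feedback moves all eigenvalues to the left of `-α / 2`, if no eigenvector of `A`
is in the kernel of `C`. -/
theorem Matrix.re_lt_of_riccati (hα : 0 < α) (hQ : Q.PosDef) (hCD : Cᵀ * D = 0)
    (hD : IsUnit (Dᵀ * D)) (hK : Kᵀ * Dᵀ * D = -(α • (Q * B)))
    (hric : Q * A + Aᵀ * Q + α • Q - (1 / α) • (Kᵀ * Dᵀ * D * K) + (1 / α) • (Cᵀ * C) = 0)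
    (hobs : ∀ (μ : ℂ) (v : ι → ℂ), A.map (algebraMap ℝ ℂ) *ᵥ v = μ • v →
      C.map (algebraMap ℝ ℂ) *ᵥ v = 0 → v = 0) :
    ∀ μ ∈ spectrum ℂ ((A + B * K).map (algebraMap ℝ ℂ)), α < -2 * μ.re := by
  have hQt : Qᵀ = Q := (conjTranspose_eq_transpose_of_trivial Q).symm.trans hQ.1
  have hDC : Dᵀ * C = 0 := by
    have := congrArg transpose hCD
    simpa using this
  have hQB : Q * B = -((1 / α) • (Kᵀ * Dᵀ * D)) := by
    rw [hK, smul_neg, neg_neg, smul_smul, one_div_mul_cancel hα.ne', one_smul]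
  have hBQ : Bᵀ * Q = -((1 / α) • (Dᵀ * (D * K))) := by
    have := congrArg transpose hQB
    simpa [transpose_mul, hQt, Matrix.mul_assoc] using this
  -- The Riccati equation is the shifted Lyapunov equation of `A + B K` with output `C + D K`,
  -- because the cross terms of the output vanish.
  refine re_lt_of_lyapunov (H := C + D * K) hα hQ ?_ ?_
  · rw [← hric]
    have e1 : Q * (B * K) = -((1 / α) • (Kᵀ * Dᵀ * D * K)) := by
      rw [← Matrix.mul_assoc, hQB, Matrix.neg_mul, Matrix.smul_mul]
    have e2 : Kᵀ * Bᵀ * Q = -((1 / α) • (Kᵀ * Dᵀ * D * K)) := by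
      rw [Matrix.mul_assoc, hBQ, Matrix.mul_neg, Matrix.mul_smul]
      simp only [Matrix.mul_assoc]
    have e3 : (C + D * K)ᵀ * (C + D * K) = Cᵀ * C + Kᵀ * Dᵀ * D * K := by
      have h1 : Cᵀ * (D * K) = 0 := by rw [← Matrix.mul_assoc, hCD, Matrix.zero_mul]
      have h2 : Kᵀ * Dᵀ * C = 0 := by rw [Matrix.mul_assoc, hDC, Matrix.mul_zero]
      rw [transpose_add, transpose_mul, Matrix.mul_add, Matrix.add_mul, Matrix.add_mul, h1, h2]
      simp only [Matrix.mul_assoc, add_zero, zero_add]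
    rw [e3, Matrix.mul_add, transpose_add, transpose_mul, Matrix.add_mul, e1, e2]
    module
  · intro μ v hv hHv
    have hDDK : Dᵀ * (C + D * K) = Dᵀ * D * K := by
      rw [Matrix.mul_add, hDC, zero_add, Matrix.mul_assoc]
    -- Orthogonality of `C` and `D` recovers `K` from `C + D K`, so a vector killed by `C + D K` is
    -- killed by both `K` and `C`, and is an eigenvector of `A` itself.
    have hKeq : (Dᵀ * D)⁻¹ * Dᵀ * (C + D * K) = K := by
      rw [Matrix.mul_assoc, hDDK, ← Matrix.mul_assoc,
        nonsing_inv_mul _ ((isUnit_iff_isUnit_det _).1 hD), Matrix.one_mul]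
    have hKv : K.map (algebraMap ℝ ℂ) *ᵥ v = 0 := by
      rw [← hKeq, Matrix.map_mul, ← mulVec_mulVec, hHv, mulVec_zero]
    refine hobs μ v ?_ ?_
    · rw [Matrix.map_add _ (map_add _), add_mulVec, Matrix.map_mul, ← mulVec_mulVec, hKv,
        mulVec_zero, add_zero] at hv
      exact hv
    · rw [Matrix.map_add _ (map_add _), add_mulVec, Matrix.map_mul, ← mulVec_mulVec, hKv,
        mulVec_zero, add_zero] at hHv
      exact hHv

end Riccati

/-! ### Lower bound for the cost and its attainment. -/

section Optimality

variable {n m k p q : ℕ} {A : Matrix (Fin n) (Fin n) ℝ}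
  {B₁ : Matrix (Fin n) (Fin p) ℝ} {B₂ : Matrix (Fin n) (Fin m) ℝ}
  {C₁ : Matrix (Fin k) (Fin n) ℝ} {C₂ : Matrix (Fin q) (Fin n) ℝ}
  {D₁ : Matrix (Fin k) (Fin p) ℝ} {D₂ : Matrix (Fin q) (Fin m) ℝ}
  {K : Matrix (Fin m) (Fin n) ℝ} {L : Matrix (Fin n) (Fin k) ℝ}
  {Q P : Matrix (Fin n) (Fin n) ℝ} {α : ℝ}

theorem lyapunov_alphaGramian_sub_fromBlocks {K' : Matrix (Fin m) (Fin n) ℝ}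
    {L' : Matrix (Fin n) (Fin k) ℝ} (hPt : Pᵀ = P) (hBD : B₁ * D₁ᵀ = 0)
    (hL : L * D₁ * D₁ᵀ = -(α • (P * C₁ᵀ)))
    (hric : A * P + P * Aᵀ + α • P - (1 / α) • (L * D₁ * D₁ᵀ * Lᵀ) + (1 / α) • (B₁ * B₁ᵀ) = 0)
    (hdef : (closedLoop A B₁ B₂ C₁ C₂ D₁ D₂ K' L').EpsNormDefined α) :
    (closedLoop A B₁ B₂ C₁ C₂ D₁ D₂ K' L').A *
        ((closedLoop A B₁ B₂ C₁ C₂ D₁ D₂ K' L').alphaGramian α - fromBlocks P 0 0 0) +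
      ((closedLoop A B₁ B₂ C₁ C₂ D₁ D₂ K' L').alphaGramian α - fromBlocks P 0 0 0) *
        (closedLoop A B₁ B₂ C₁ C₂ D₁ D₂ K' L').Aᵀ +
      α • ((closedLoop A B₁ B₂ C₁ C₂ D₁ D₂ K' L').alphaGramian α - fromBlocks P 0 0 0) +
      (1 / α) • (fromRows (L * D₁) (L' * D₁) * (fromRows (L * D₁) (L' * D₁))ᵀ) = 0 := by
  have h1 := lyapunov_closedLoop_fromBlocks (B₂ := B₂) (C₂ := C₂) (D₂ := D₂) hdef.1.ne' K' L' hPt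
    hBD hL hric
  have h2 := LTISystem.isAlphaGramian_alphaGramian _ hdef
  rw [LTISystem.IsAlphaGramian] at h2
  rw [← h1, Matrix.mul_sub, Matrix.sub_mul, smul_sub]
  refine Eq.trans ?_ h2
  abel

/-- Only the last term depends on `K'` and `L'`. The matrix `P` is arbitrary here: it is added and
subtracted inside `tr(F Π Fᵀ)`. -/
theorem trace_closedLoop_alphaGramian {K' : Matrix (Fin m) (Fin n) ℝ}
    {L' : Matrix (Fin n) (Fin k) ℝ} (hQt : Qᵀ = Q) (hCD : C₂ᵀ * D₂ = 0)
    (hK : Kᵀ * D₂ᵀ * D₂ = -(α • (Q * B₂)))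
    (hric : Q * A + Aᵀ * Q + α • Q - (1 / α) • (Kᵀ * D₂ᵀ * D₂ * K) + (1 / α) • (C₂ᵀ * C₂) = 0)
    (hdef : (closedLoop A B₁ B₂ C₁ C₂ D₁ D₂ K' L').EpsNormDefined α) :
    ((closedLoop A B₁ B₂ C₁ C₂ D₁ D₂ K' L').C *
      (closedLoop A B₁ B₂ C₁ C₂ D₁ D₂ K' L').alphaGramian α *
      (closedLoop A B₁ B₂ C₁ C₂ D₁ D₂ K' L').Cᵀ).trace =
    (B₁ᵀ * Q * B₁).trace + (D₂ * K * P * Kᵀ * D₂ᵀ).trace +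
      (D₂ * fromCols K (-K') *
        ((closedLoop A B₁ B₂ C₁ C₂ D₁ D₂ K' L').alphaGramian α - fromBlocks P 0 0 0) *
        (D₂ * fromCols K (-K'))ᵀ).trace := by
  have h1 := dual_lyapunov_closedLoop_fromBlocks (B₁ := B₁) (C₁ := C₁) (D₁ := D₁) hdef.1.ne' K' L'
    hQt hCD hK hric
  rw [LTISystem.trace_mul_of_isAlphaGramian hdef.1.ne'
    (LTISystem.isAlphaGramian_alphaGramian _ hdef) h1, Matrix.mul_sub, Matrix.sub_mul, trace_sub]
  have e1 : (closedLoop A B₁ B₂ C₁ C₂ D₁ D₂ K' L').Bᵀ *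
      (fromBlocks Q 0 0 0 : Matrix (Fin n ⊕ Fin n) (Fin n ⊕ Fin n) ℝ) *
      (closedLoop A B₁ B₂ C₁ C₂ D₁ D₂ K' L').B = B₁ᵀ * Q * B₁ := by
    simp [closedLoop, transpose_fromRows, fromCols_mul_fromBlocks, fromCols_mul_fromRows]
  have e2 : D₂ * fromCols K (-K') *
      (fromBlocks P 0 0 0 : Matrix (Fin n ⊕ Fin n) (Fin n ⊕ Fin n) ℝ) * (D₂ * fromCols K (-K'))ᵀ =
      D₂ * K * P * Kᵀ * D₂ᵀ := by
    rw [mul_fromCols]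
    simp [transpose_fromCols, fromCols_mul_fromBlocks, fromCols_mul_fromRows, Matrix.mul_assoc]
  rw [e1, e2]
  ring

theorem le_trace_closedLoop_alphaGramian {K' : Matrix (Fin m) (Fin n) ℝ}
    {L' : Matrix (Fin n) (Fin k) ℝ} (hQt : Qᵀ = Q) (hPt : Pᵀ = P) (hBD : B₁ * D₁ᵀ = 0)
    (hCD : C₂ᵀ * D₂ = 0) (hL : L * D₁ * D₁ᵀ = -(α • (P * C₁ᵀ)))
    (hricP : A * P + P * Aᵀ + α • P - (1 / α) • (L * D₁ * D₁ᵀ * Lᵀ) + (1 / α) • (B₁ * B₁ᵀ) = 0)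
    (hK : Kᵀ * D₂ᵀ * D₂ = -(α • (Q * B₂)))
    (hricQ : Q * A + Aᵀ * Q + α • Q - (1 / α) • (Kᵀ * D₂ᵀ * D₂ * K) + (1 / α) • (C₂ᵀ * C₂) = 0)
    (hdef : (closedLoop A B₁ B₂ C₁ C₂ D₁ D₂ K' L').EpsNormDefined α) :
    (B₁ᵀ * Q * B₁).trace + (D₂ * K * P * Kᵀ * D₂ᵀ).trace ≤
      ((closedLoop A B₁ B₂ C₁ C₂ D₁ D₂ K' L').C *
      (closedLoop A B₁ B₂ C₁ C₂ D₁ D₂ K' L').alphaGramian α *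
      (closedLoop A B₁ B₂ C₁ C₂ D₁ D₂ K' L').Cᵀ).trace := by
  rw [trace_closedLoop_alphaGramian (P := P) hQt hCD hK hricQ hdef]
  refine le_add_of_nonneg_right ?_
  have hN := (posSemidef_self_mul_conjTranspose (fromRows (L * D₁) (L' * D₁))).smul
    (one_div_nonneg.2 hdef.1.le)
  rw [conjTranspose_eq_transpose_of_trivial] at hN
  have hE := posSemidef_of_shifted_lyapunov hdef.2 hN
    (lyapunov_alphaGramian_sub_fromBlocks hPt hBD hL hricP hdef)
  have := (hE.mul_mul_conjTranspose_same (D₂ * fromCols K (-K'))).trace_nonneg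
  rwa [conjTranspose_eq_transpose_of_trivial] at this

theorem trace_closedLoop_alphaGramian_of_riccati (hQt : Qᵀ = Q) (hPt : Pᵀ = P)
    (hBD : B₁ * D₁ᵀ = 0) (hCD : C₂ᵀ * D₂ = 0) (hL : L * D₁ * D₁ᵀ = -(α • (P * C₁ᵀ)))
    (hricP : A * P + P * Aᵀ + α • P - (1 / α) • (L * D₁ * D₁ᵀ * Lᵀ) + (1 / α) • (B₁ * B₁ᵀ) = 0)
    (hK : Kᵀ * D₂ᵀ * D₂ = -(α • (Q * B₂)))
    (hricQ : Q * A + Aᵀ * Q + α • Q - (1 / α) • (Kᵀ * D₂ᵀ * D₂ * K) + (1 / α) • (C₂ᵀ * C₂) = 0)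
    (hobs : ∀ μ ∈ spectrum ℂ ((A + L * C₁).map (algebraMap ℝ ℂ)), α < -2 * μ.re)
    (hdef : (closedLoop A B₁ B₂ C₁ C₂ D₁ D₂ K L).EpsNormDefined α) :
    ((closedLoop A B₁ B₂ C₁ C₂ D₁ D₂ K L).C *
      (closedLoop A B₁ B₂ C₁ C₂ D₁ D₂ K L).alphaGramian α *
      (closedLoop A B₁ B₂ C₁ C₂ D₁ D₂ K L).Cᵀ).trace =
    (B₁ᵀ * Q * B₁).trace + (D₂ * K * P * Kᵀ * D₂ᵀ).trace := by
  rw [trace_closedLoop_alphaGramian (P := P) hQt hCD hK hricQ hdef, add_eq_left]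
  have hE := lyapunov_alphaGramian_sub_fromBlocks hPt hBD hL hricP hdef
  set E := (closedLoop A B₁ B₂ C₁ C₂ D₁ D₂ K L).alphaGramian α - fromBlocks P 0 0 0
  -- `J` maps the state `(x, x̂)` to the estimation error `x - x̂`.
  set J : Matrix (Fin n) (Fin n ⊕ Fin n) ℝ := fromCols 1 (-1) with hJ
  have hJA : J * (closedLoop A B₁ B₂ C₁ C₂ D₁ D₂ K L).A = (A + L * C₁) * J := by
    simp only [hJ, closedLoop, fromCols_mul_fromBlocks, mul_fromCols, Matrix.one_mul,
      Matrix.neg_mul, Matrix.mul_neg, Matrix.mul_one]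
    congr 1 <;> abel
  have hAJ : (closedLoop A B₁ B₂ C₁ C₂ D₁ D₂ K L).Aᵀ * Jᵀ = Jᵀ * (A + L * C₁)ᵀ := by
    rw [← transpose_mul, hJA, transpose_mul]
  have hJG : J * fromRows (L * D₁) (L * D₁) = 0 := by
    simp [hJ, fromCols_mul_fromRows]
  -- With equal observer gains the forcing of `E` has two equal halves, so `J` removes it, and
  -- stability of `A + L C₁` leaves only the zero solution.
  have hX : J * E * Jᵀ = 0 := by
    refine eq_zero_of_shifted_lyapunov hdef.1 hobs ?_
    have h1 := congrArg (fun Z => J * Z * Jᵀ) hE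
    simp only [Matrix.mul_add, Matrix.add_mul, Matrix.mul_smul, Matrix.smul_mul, Matrix.mul_zero,
      Matrix.zero_mul] at h1
    have h2 : J * (fromRows (L * D₁) (L * D₁) * (fromRows (L * D₁) (L * D₁))ᵀ) = 0 := by
      rw [← Matrix.mul_assoc, hJG, Matrix.zero_mul]
    have h3 : J * ((closedLoop A B₁ B₂ C₁ C₂ D₁ D₂ K L).A * E) * Jᵀ =
        (A + L * C₁) * (J * E * Jᵀ) := by
      rw [← Matrix.mul_assoc, hJA]
      simp only [Matrix.mul_assoc]
    have h4 : J * (E * (closedLoop A B₁ B₂ C₁ C₂ D₁ D₂ K L).Aᵀ) * Jᵀ =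
        J * E * Jᵀ * (A + L * C₁)ᵀ := by
      rw [Matrix.mul_assoc, Matrix.mul_assoc, hAJ]
      simp only [Matrix.mul_assoc]
    rw [h2, h3, h4, Matrix.zero_mul, smul_zero, add_zero] at h1
    exact h1
  have hF : fromCols K (-K) = K * J := by
    rw [hJ, mul_fromCols, Matrix.mul_one, Matrix.mul_neg, Matrix.mul_one]
  have : D₂ * fromCols K (-K) * E * (D₂ * fromCols K (-K))ᵀ = D₂ * K * (J * E * Jᵀ) * (D₂ * K)ᵀ := by
    rw [hF, ← Matrix.mul_assoc, transpose_mul (D₂ * K) J]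
    simp only [Matrix.mul_assoc]
  rw [this, hX, Matrix.mul_zero, Matrix.zero_mul, trace_zero]

/-- Pair the filter equation with `Q` and the control equation with `P`: the terms in `A` and `α`
have equal traces, and the quadratic terms trade places. -/
theorem trace_riccati_cost_eq (hα : α ≠ 0)
    (hricP : A * P + P * Aᵀ + α • P - (1 / α) • (L * D₁ * D₁ᵀ * Lᵀ) + (1 / α) • (B₁ * B₁ᵀ) = 0)
    (hricQ : Q * A + Aᵀ * Q + α • Q - (1 / α) • (Kᵀ * D₂ᵀ * D₂ * K) + (1 / α) • (C₂ᵀ * C₂) = 0) :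
    (B₁ᵀ * Q * B₁).trace + (D₂ * K * P * Kᵀ * D₂ᵀ).trace =
      (C₂ * P * C₂ᵀ).trace + (D₁ᵀ * Lᵀ * Q * L * D₁).trace := by
  have h1 := congrArg (fun Z => (Q * Z).trace) hricP
  have h2 := congrArg (fun Z => (P * Z).trace) hricQ
  simp only [Matrix.mul_add, Matrix.mul_sub, Matrix.mul_smul, trace_add, trace_sub, trace_smul,
    smul_eq_mul, Matrix.mul_zero, trace_zero] at h1 h2
  have e1 : (Q * (A * P)).trace = (P * (Q * A)).trace := by
    rw [← Matrix.mul_assoc, trace_mul_comm]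
  have e2 : (Q * (P * Aᵀ)).trace = (P * (Aᵀ * Q)).trace := by
    rw [trace_mul_comm, Matrix.mul_assoc]
  have e3 : (Q * (B₁ * B₁ᵀ)).trace = (B₁ᵀ * Q * B₁).trace := by
    rw [← Matrix.mul_assoc, trace_mul_comm, Matrix.mul_assoc]
  have e4 : (P * (C₂ᵀ * C₂)).trace = (C₂ * P * C₂ᵀ).trace := by
    rw [← Matrix.mul_assoc, trace_mul_comm, Matrix.mul_assoc]
  have e5 : (Q * (L * D₁ * D₁ᵀ * Lᵀ)).trace = (D₁ᵀ * Lᵀ * Q * L * D₁).trace := by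
    rw [Matrix.mul_assoc (L * D₁), ← Matrix.mul_assoc, trace_mul_comm]
    simp only [Matrix.mul_assoc]
  have e6 : (P * (Kᵀ * D₂ᵀ * D₂ * K)).trace = (D₂ * K * P * Kᵀ * D₂ᵀ).trace := by
    rw [Matrix.mul_assoc (Kᵀ * D₂ᵀ), ← Matrix.mul_assoc, trace_mul_comm]
    simp only [Matrix.mul_assoc]
  rw [e1, e2, e3, e5, trace_mul_comm Q P] at h1
  rw [e4, e6] at h2
  refine mul_left_cancel₀ (one_div_ne_zero hα) ?_
  linarith

end Optimality

theorem mainTheorem1 {n m k p q : ℕ}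
    (A : Matrix (Fin n) (Fin n) ℝ)
    (B₁ : Matrix (Fin n) (Fin p) ℝ) (B₂ : Matrix (Fin n) (Fin m) ℝ)
    (C₁ : Matrix (Fin k) (Fin n) ℝ) (C₂ : Matrix (Fin q) (Fin n) ℝ)
    (D₁ : Matrix (Fin k) (Fin p) ℝ) (D₂ : Matrix (Fin q) (Fin m) ℝ)
    (hAB₂ : IsStabilizable A B₂) (hC₁A : IsDetectable C₁ A)
    (hAB₁ : IsControllable A B₁) (hC₂A : IsObservable C₂ A)
    (hBD : B₁ * D₁ᵀ = 0) (hCD : C₂ᵀ * D₂ = 0)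
    (hD₁ : IsUnit (D₁ * D₁ᵀ)) (hD₂ : IsUnit (D₂ᵀ * D₂))
    (α : ℝ) (hα : 0 < α)
    (Q P : Matrix (Fin n) (Fin n) ℝ) (hQ : Q.PosDef) (hP : P.PosDef)
    (hricQ : Q * A + Aᵀ * Q + α • Q - α • (Q * B₂ * (D₂ᵀ * D₂)⁻¹ * B₂ᵀ * Q)
      + (1 / α) • (C₂ᵀ * C₂) = 0)
    (hricP : A * P + P * Aᵀ + α • P - α • (P * C₁ᵀ * (D₁ * D₁ᵀ)⁻¹ * C₁ * P)
      + (1 / α) • (B₁ * B₁ᵀ) = 0)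
    (K : Matrix (Fin m) (Fin n) ℝ) (hK : K = -(α • ((D₂ᵀ * D₂)⁻¹ * B₂ᵀ * Q)))
    (L : Matrix (Fin n) (Fin k) ℝ) (hL : L = -(α • (P * C₁ᵀ * (D₁ * D₁ᵀ)⁻¹))) :
    (closedLoop A B₁ B₂ C₁ C₂ D₁ D₂ K L).IsStable ∧
    (closedLoop A B₁ B₂ C₁ C₂ D₁ D₂ K L).EpsNormDefined α ∧
    (∀ (K' : Matrix (Fin m) (Fin n) ℝ) (L' : Matrix (Fin n) (Fin k) ℝ),
      (closedLoop A B₁ B₂ C₁ C₂ D₁ D₂ K' L').EpsNormDefined α →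
        (closedLoop A B₁ B₂ C₁ C₂ D₁ D₂ K L).epsNorm α ≤
          (closedLoop A B₁ B₂ C₁ C₂ D₁ D₂ K' L').epsNorm α) ∧
    (closedLoop A B₁ B₂ C₁ C₂ D₁ D₂ K L).epsNorm α =
      Real.sqrt ((B₁ᵀ * Q * B₁).trace + (D₂ * K * P * Kᵀ * D₂ᵀ).trace) ∧
    (closedLoop A B₁ B₂ C₁ C₂ D₁ D₂ K L).epsNorm α =
      Real.sqrt ((C₂ * P * C₂ᵀ).trace + (D₁ᵀ * Lᵀ * Q * L * D₁).trace) := by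
  have hQt : Qᵀ = Q := (conjTranspose_eq_transpose_of_trivial Q).symm.trans hQ.1
  have hPt : Pᵀ = P := (conjTranspose_eq_transpose_of_trivial P).symm.trans hP.1
  have hRt : ((D₂ᵀ * D₂)⁻¹)ᵀ = (D₂ᵀ * D₂)⁻¹ := by simp [transpose_nonsing_inv]
  have hVt : ((D₁ * D₁ᵀ)⁻¹)ᵀ = (D₁ * D₁ᵀ)⁻¹ := by simp [transpose_nonsing_inv]
  have hKD : Kᵀ * D₂ᵀ * D₂ = -(α • (Q * B₂)) := by
    rw [hK, Matrix.mul_assoc]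
    simp only [transpose_neg, transpose_smul, transpose_mul _ Q, transpose_mul _ B₂ᵀ,
      transpose_transpose, hQt, hRt, Matrix.neg_mul, Matrix.smul_mul]
    rw [← Matrix.mul_assoc Q, Matrix.mul_assoc (Q * B₂),
      nonsing_inv_mul _ ((isUnit_iff_isUnit_det _).1 hD₂), Matrix.mul_one]
  have hLD : L * D₁ * D₁ᵀ = -(α • (P * C₁ᵀ)) := by
    rw [hL, Matrix.mul_assoc]
    simp only [Matrix.neg_mul, Matrix.smul_mul]
    rw [Matrix.mul_assoc (P * C₁ᵀ), nonsing_inv_mul _ ((isUnit_iff_isUnit_det _).1 hD₁),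
      Matrix.mul_one]
  have hricQ' : Q * A + Aᵀ * Q + α • Q - (1 / α) • (Kᵀ * D₂ᵀ * D₂ * K) +
      (1 / α) • (C₂ᵀ * C₂) = 0 := by
    have : (1 / α) • (Kᵀ * D₂ᵀ * D₂ * K) = α • (Q * B₂ * (D₂ᵀ * D₂)⁻¹ * B₂ᵀ * Q) := by
      rw [hKD, hK]
      simp only [Matrix.neg_mul, Matrix.smul_mul, Matrix.mul_neg, Matrix.mul_smul, neg_neg,
        smul_smul, ← Matrix.mul_assoc, smul_neg]
      rw [one_div, inv_mul_cancel_left₀ hα.ne']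
    rw [this]
    exact hricQ
  have hricP' : A * P + P * Aᵀ + α • P - (1 / α) • (L * D₁ * D₁ᵀ * Lᵀ) +
      (1 / α) • (B₁ * B₁ᵀ) = 0 := by
    have : (1 / α) • (L * D₁ * D₁ᵀ * Lᵀ) = α • (P * C₁ᵀ * (D₁ * D₁ᵀ)⁻¹ * C₁ * P) := by
      rw [hLD, hL]
      simp only [transpose_neg, transpose_smul, transpose_mul, transpose_transpose, hPt, hVt,
        Matrix.neg_mul, Matrix.smul_mul, Matrix.mul_neg, Matrix.mul_smul, neg_neg,
        smul_smul, ← Matrix.mul_assoc, smul_neg]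
      rw [one_div, inv_mul_cancel_left₀ hα.ne']
    rw [this]
    exact hricP
  have hreg : ∀ μ ∈ spectrum ℂ ((A + B₂ * K).map (algebraMap ℝ ℂ)), α < -2 * μ.re :=
    re_lt_of_riccati hα hQ hCD hD₂ hKD hricQ' fun _ _ => hC₂A.eq_zero_of_eigenvector
  have hobs : ∀ μ ∈ spectrum ℂ ((A + L * C₁).map (algebraMap ℝ ℂ)), α < -2 * μ.re := by
    -- The filter is the control problem of the transposed plant, with controllability of `(A, B₁)`
    -- in the role of observability.
    have := re_lt_of_riccati (A := Aᵀ) (B := C₁ᵀ) (C := B₁ᵀ) (D := D₁ᵀ) (K := Lᵀ) hα hP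
      (by simpa using hBD) (by simpa using hD₁) (by simpa using hLD)
      (by simpa [add_comm (P * Aᵀ), Matrix.mul_assoc] using hricP')
      fun _ _ => hAB₁.eq_zero_of_eigenvector
    rwa [← transpose_mul, ← transpose_add, transpose_map, spectrum_transpose] at this
  have hdef : (closedLoop A B₁ B₂ C₁ C₂ D₁ D₂ K L).EpsNormDefined α :=
    ⟨hα, fun μ hμ => (spectrum_closedLoop_subset hμ).elim (hreg μ) (hobs μ)⟩
  have hval := trace_closedLoop_alphaGramian_of_riccati hQt hPt hBD hCD hLD hricP' hKD hricQ' hobs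
    hdef
  refine ⟨fun μ hμ => ?_, hdef, fun K' L' hdef' => ?_, ?_, ?_⟩
  · have := hdef.2 μ hμ
    linarith
  · rw [LTISystem.epsNorm, LTISystem.epsNorm, hval]
    exact Real.sqrt_le_sqrt
      (le_trace_closedLoop_alphaGramian hQt hPt hBD hCD hLD hricP' hKD hricQ' hdef')
  · rw [LTISystem.epsNorm, hval]
  · rw [LTISystem.epsNorm, hval, trace_riccati_cost_eq hα.ne' hricP' hricQ']
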